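/- Let $M$ be a matroid on a finite ground set $E$, let $m, \Delta \ge 0$ be integers, and let $W \in \{-\Delta,\dots,\Delta\}^{m\times E}$ be an integer matrix whose column $W(e)$ is the ($m$-dimensional) weight of the element $e \in E$. For $S \subseteq E$ let $\chi(S) \in \{0,1\}^E$ be its characteristic vector and $W(S) = \sum_{e\in S} W(e) = W\chi(S)$ its weight. Let $P_B(M) \subseteq [0,1]^E$ be the base polytope of $M$, that is, the convex hull of the vectors $\chi(B)$ over all bases $B$ of $M$. Let $A$ be a basis of $M$ and let $x^*$ be any vertex (extreme point) of the polytope $$\{x \in \mathbb{R}^E : x \in P_B(M),\ Wx = W(A)\}.$$ Then there exists a basis $A'$ of $M$ with $W(A') = W(A)$ and $$\|x^* - \chi(A')\|_1 \le (2m\Delta)^{13m},$$ where $(2m\Delta)^{13m}$ is read as $1$ if $m = 0$. -/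

import Mathlib

open scoped Matrix

namespace MatroidProximity

/-- The characteristic vector `χ(S) ∈ {0,1}^E` of a set `S ⊆ E`, with entries in `R`. -/
noncomputable def charVec {E : Type*} (R : Type*) [Zero R] [One R] (S : Set E) : E → R :=
  S.indicator 1

/-- The weight `W(S) = W ⬝ χ(S)` of a set `S ⊆ E`, that is, the sum of the columns `W(e)`, `e ∈ S`,
of the integer matrix `W`. -/
noncomputable def weight {E : Type*} [Fintype E] {m : ℕ} (W : Matrix (Fin m) E ℤ) (S : Set E) :
    Fin m → ℤ :=
  W *ᵥ charVec ℤ S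

/-- The base polytope `P_B(M) ⊆ ℝ^E`: the convex hull of the characteristic vectors of the bases
of `M`. -/
def basePolytope {E : Type*} (M : Matroid E) : Set (E → ℝ) :=
  convexHull ℝ {x | ∃ B : Set E, M.IsBase B ∧ x = charVec ℝ B}

/-- The polytope `{x ∈ ℝ^E : x ∈ P_B(M), W x = β}`. -/
def exactPolytope {E : Type*} [Fintype E] {m : ℕ} (M : Matroid E) (W : Matrix (Fin m) E ℤ)
    (β : Fin m → ℤ) : Set (E → ℝ) :=
  {x | x ∈ basePolytope M ∧ (W.map (fun z : ℤ => (z : ℝ))) *ᵥ x = fun i => (β i : ℝ)}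

end MatroidProximity

/-!
The point `x` lies on a small face of the base polytope: the two-sided directions of the polytope at
`x` meet the kernel of `W` trivially, and they contain the direction `χ(f) - χ(e)` of every symmetric
exchange between bases in a convex representation of `x`. Hence `x` is within `ℓ₁`-distance `2m` of a
basis `B` (`exists_isBase_near_extremePoint`), and `W(B)` differs from `W(A)` by at most `2mΔ` in each
coordinate.

Among the bases of weight `W(A)` let `A'` minimize `|A' \ B|`. If this number is large, there is a
basis of the same weight with fewer elements outside `B` (`exists_isBase_card_sdiff_lt`). After
contracting `A' ∩ B` the bases are disjoint. Group the elements into types by their column and by the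
basis they belong to; there are at most `p = (2Δ+1)^m` types on each side. A set `X` of types bounds
the number of elements of a basis with type in `X` by a rank, and the slack of this bound at `A'` is
a submodular function of `X`. Call an exchange between two types cheap if some set of slack less than
`K` separates them. By uncrossing and Hall's theorem, all but `K p²` elements of `B` can be matched
with elements of `A'` along exchanges that are not cheap (`exists_matching_of_isBase`). The weight
differences along the matching have a short sum, so a nonempty multiset of at most `K` of them sums to
zero (`exists_zero_sum_combination`). The corresponding change of the type counts respects every
slack: a set separating one of the chosen exchanges has slack at least `K`, and the count of any
other set does not increase. By Rado's theorem (`exists_isBase_of_slack`) a basis realizes the new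
counts; it has the weight of `A'` and contains an element of `B`.
-/

namespace MatroidProximity

/-! ### Short integer relations -/

/-- Integer vectors in `[-c, c]^m` whose sum is short compared with their number satisfy a nontrivial
nonnegative integer relation of bounded size. Carathéodory's theorem writes the mean of the vectors
as a convex combination `w` of at most `m + 1` of them. The roundings `⌊t • w⌋`, for `t` growing until
some coefficient of at least average size has reached `(2mc+1)^m`, form an increasing sequence of
multiplicities whose weighted sums stay in a box with `(2mc+1)^m` integer points; the difference of two multiplicities
with the same weighted sum is the relation. A vector may be used more than once. -/
theorem exists_zero_sum_combination {m : ℕ} {I : Type*} [Fintype I] [Nonempty I]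
    (ρ : I → Fin m → ℤ) (c : ℕ) (hρ : ∀ i k, |ρ i k| ≤ c)
    (hsum : ∀ k, ((m + 1) * (2 * (m * c) + 1) ^ m : ℕ) * |∑ i, ρ i k| < Fintype.card I) :
    ∃ z : I → ℕ, z ≠ 0 ∧ ∑ i, z i ≤ (m + 1) * (2 * (m * c) + 1) ^ m ∧
      ∀ k, ∑ i, (z i : ℤ) * ρ i k = 0 := by
  classical
  set P : ℕ := (2 * (m * c) + 1) ^ m with hP
  have hn : (0 : ℝ) < Fintype.card I := by exact_mod_cast Fintype.card_pos
  let r : I → Fin m → ℝ := fun i k => (ρ i k : ℝ)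
  let y : Fin m → ℝ := ∑ i, (1 / (Fintype.card I : ℝ)) • r i
  have hy : y ∈ convexHull ℝ (Set.range r) := by
    refine (convex_convexHull ℝ _).sum_mem (fun i _ => by positivity) ?_
      (fun i _ => subset_convexHull ℝ _ ⟨i, rfl⟩)
    simp [hn.ne']
  have hyk : ∀ k, |y k| * ((m + 1) * P : ℕ) < 1 := by
    intro k
    have h1 : y k = (∑ i, ρ i k : ℤ) / (Fintype.card I : ℝ) := by
      simp only [y, r, Finset.sum_apply, Pi.smul_apply, smul_eq_mul, ← Finset.mul_sum]
      push_cast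
      ring
    have h2 := hsum k
    have h3 : (((m + 1) * P : ℕ) : ℝ) * |((∑ i, ρ i k : ℤ) : ℝ)| < Fintype.card I := by
      exact_mod_cast h2
    rw [h1, abs_div, abs_of_pos hn, div_mul_eq_mul_div, div_lt_one hn]
    linarith
  obtain ⟨κ, _, p, w, hp, haff, hw, hw1, hwy⟩ := eq_pos_convex_span_of_mem_convexHull hy
  have hcard : Fintype.card κ ≤ m + 1 := by
    have := haff.card_le_finrank_succ
    have h2 : Module.finrank ℝ (vectorSpan ℝ (Set.range p)) ≤ m := by
      simpa using Submodule.finrank_le (vectorSpan ℝ (Set.range p))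
    omega
  choose g hg using fun a => hp (Set.mem_range_self a)
  -- an index whose weight is at least the average weight
  obtain ⟨a₀, ha₀⟩ : ∃ a, 1 ≤ (m + 1) * w a := by
    by_contra! hcon
    have hne : (Finset.univ : Finset κ).Nonempty := by
      rw [Finset.nonempty_iff_ne_empty]
      intro h
      rw [h] at hw1
      simp at hw1
    have h1 : ∑ a, (m + 1 : ℝ) * w a < ∑ a : κ, (1 : ℝ) :=
      Finset.sum_lt_sum_of_nonempty hne fun a _ => hcon a
    rw [← Finset.mul_sum, hw1] at h1
    have h2 : (Fintype.card κ : ℝ) ≤ m + 1 := by exact_mod_cast hcard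
    simp at h1
    linarith
  have hwa₀ := hw a₀
  -- at time `t j` the coefficient of `a₀` is exactly `j`, so its rounding makes no error
  let t : ℕ → ℝ := fun j => j / w a₀
  have ht0 : ∀ j, 0 ≤ t j := fun j => by positivity
  have htmono : ∀ i j, i ≤ j → t i ≤ t j := fun i j hij => by
    have : (i : ℝ) ≤ j := by exact_mod_cast hij
    exact div_le_div_of_nonneg_right this hwa₀.le
  have htK : ∀ j ≤ P, t j ≤ ((m + 1) * P : ℕ) := by
    intro j hj
    have : (j : ℝ) ≤ P := by exact_mod_cast hj
    rw [div_le_iff₀ hwa₀]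
    push_cast
    nlinarith
  let u : ℕ → κ → ℕ := fun j a => ⌊t j * w a⌋₊
  have hu₀ : ∀ j, u j a₀ = j := fun j => by
    simp [u, t, div_mul_cancel₀ _ hwa₀.ne']
  let s : ℕ → Fin m → ℤ := fun j k => ∑ a, (u j a : ℤ) * ρ (g a) k
  have hgp : ∀ a k, (ρ (g a) k : ℝ) = p a k := fun a k => congrFun (hg a) k
  -- only the `m` coordinates other than `a₀` contribute a rounding error
  have hs : ∀ j ≤ P, ∀ k, |s j k| ≤ m * c := by
    intro j hj k
    have hyk' : ∑ a, w a * p a k = y k := by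
      rw [← hwy]; simp [Finset.sum_apply]
    have h1 : (s j k : ℝ) = t j * y k - ∑ a, (t j * w a - u j a) * p a k := by
      simp only [s]
      push_cast
      rw [← hyk', Finset.mul_sum, ← Finset.sum_sub_distrib]
      refine Finset.sum_congr rfl fun a _ => ?_
      rw [hgp]
      ring
    have h2 : |∑ a, (t j * w a - u j a) * p a k| ≤ m * c := by
      rw [← Finset.add_sum_erase _ _ (Finset.mem_univ a₀), hu₀]
      have : t j * w a₀ - j = 0 := by simp [t, div_mul_cancel₀ _ hwa₀.ne']
      rw [this, zero_mul, zero_add]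
      refine (Finset.abs_sum_le_sum_abs _ _).trans ?_
      have h3 : ∀ a ∈ Finset.univ.erase a₀, |(t j * w a - u j a) * p a k| ≤ c := by
        intro a _
        have h4 : |p a k| ≤ c := by
          rw [← hgp]; exact_mod_cast hρ (g a) k
        have h5 : (0 : ℝ) ≤ t j * w a - u j a :=
          sub_nonneg.2 (Nat.floor_le (mul_nonneg (ht0 j) (hw a).le))
        have h6 : t j * w a - u j a ≤ 1 := by
          have := Nat.lt_floor_add_one (t j * w a)
          simp only [u]
          linarith
        rw [abs_mul, abs_of_nonneg h5]
        nlinarith [abs_nonneg (p a k)]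
      refine (Finset.sum_le_card_nsmul _ _ _ h3).trans ?_
      rw [nsmul_eq_mul, Finset.card_erase_of_mem (Finset.mem_univ _), Finset.card_univ]
      have : ((Fintype.card κ - 1 : ℕ) : ℝ) ≤ m := by exact_mod_cast (by omega)
      exact mul_le_mul_of_nonneg_right this (by positivity)
    have h3 : |t j * y k| < 1 := by
      rw [abs_mul, abs_of_nonneg (ht0 j)]
      refine lt_of_le_of_lt ?_ (hyk k)
      rw [mul_comm]
      exact mul_le_mul_of_nonneg_left (htK j hj) (abs_nonneg _)
    have h4 : |(s j k : ℝ)| < m * c + 1 := by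
      rw [h1]
      exact (abs_sub _ _).trans_lt (by linarith)
    have h5 : |s j k| < (m * c + 1 : ℤ) := by exact_mod_cast h4
    omega
  -- `P + 1` values in a box with `P` integer points
  obtain ⟨i, hi, j, hj, hij, hsij⟩ : ∃ i ∈ Finset.range (P + 1), ∃ j ∈ Finset.range (P + 1),
      i ≠ j ∧ s i = s j := by
    refine Finset.exists_ne_map_eq_of_card_lt_of_maps_to
      (t := Fintype.piFinset fun _ : Fin m => Finset.Icc (-(m * c : ℤ)) (m * c)) ?_ ?_
    · rw [Fintype.card_piFinset]
      have : ((m * c : ℤ) + 1 - -(m * c : ℤ)).toNat = 2 * (m * c) + 1 := by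
        have : ((m * c : ℤ) + 1 - -(m * c : ℤ)) = ((2 * (m * c) + 1 : ℕ) : ℤ) := by
          push_cast; ring
        rw [this, Int.toNat_natCast]
      simp only [Int.card_Icc, this]
      simp [hP]
    · intro j hj
      rw [Finset.coe_range, Set.mem_Iio] at hj
      simp only [Finset.mem_coe, Fintype.mem_piFinset, Finset.mem_Icc]
      exact fun k => abs_le.1 (hs j (by omega) k)
  obtain ⟨i, j, hj, hij, hsij⟩ : ∃ i j, j ≤ P ∧ i < j ∧ s i = s j := by
    simp only [Finset.mem_range] at hi hj
    rcases lt_or_gt_of_ne hij with h | h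
    · exact ⟨i, j, by omega, h, hsij⟩
    · exact ⟨j, i, by omega, h, hsij.symm⟩
  have humono : ∀ a, u i a ≤ u j a := fun a =>
    Nat.floor_mono (mul_le_mul_of_nonneg_right (htmono _ _ hij.le) (hw a).le)
  refine ⟨fun e => ∑ a with g a = e, (u j a - u i a), ?_, ?_, ?_⟩
  · intro h
    have h1 := congrFun h (g a₀)
    simp only [Pi.zero_apply, Finset.sum_eq_zero_iff, Finset.mem_filter, Finset.mem_univ,
      true_and] at h1
    have := h1 a₀ rfl
    rw [hu₀, hu₀] at this
    omega
  · have h0 := Finset.sum_fiberwise Finset.univ g fun a => u j a - u i a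
    have h1 : ((∑ a, u j a : ℕ) : ℝ) ≤ t j := by
      push_cast
      calc ∑ a, (u j a : ℝ) ≤ ∑ a, t j * w a :=
            Finset.sum_le_sum fun a _ => Nat.floor_le (mul_nonneg (ht0 j) (hw a).le)
        _ = t j := by rw [← Finset.mul_sum, hw1, mul_one]
    have h2 : ∑ a, u j a ≤ (m + 1) * P := by exact_mod_cast h1.trans (htK j hj)
    refine (Eq.le ?_).trans ((Finset.sum_le_sum fun a _ => Nat.sub_le _ (u i a)).trans h2)
    convert h0
  · intro k
    have h1 : ∑ e, ((∑ a with g a = e, (u j a - u i a) : ℕ) : ℤ) * ρ e k =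
        ∑ a, ((u j a - u i a : ℕ) : ℤ) * ρ (g a) k := by
      rw [← Finset.sum_fiberwise Finset.univ g]
      refine Finset.sum_congr rfl fun e _ => ?_
      push_cast
      rw [Finset.sum_mul]
      refine Finset.sum_congr rfl fun a ha => ?_
      rw [(Finset.mem_filter.1 ha).2]
    have h2 := congrFun hsij k
    simp only [s] at h2
    rw [h1, ← sub_eq_zero.2 h2.symm, ← Finset.sum_sub_distrib]
    refine Finset.sum_congr rfl fun a _ => ?_
    rw [Nat.cast_sub (humono a)]
    ring

/-! ### Rank and independent transversals -/

/-- The rank of a set as a natural number; on a finite type no information is lost. -/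
noncomputable def rk {E : Type*} (M : Matroid E) (X : Set E) : ℕ := (M.eRk X).toNat

section Rank

variable {E : Type*} [Finite E] (M : Matroid E)

theorem coe_rk (X : Set E) : (rk M X : ℕ∞) = M.eRk X :=
  ENat.natCast_toNat (Matroid.eRk_ne_top_iff.2 (M.isRkFinite_of_finite X.toFinite))

theorem rk_mono {X Y : Set E} (h : X ⊆ Y) : rk M X ≤ rk M Y := by
  have := M.eRk_mono h
  rw [← coe_rk, ← coe_rk] at this
  exact_mod_cast this

theorem rk_inter_add_rk_union_le (X Y : Set E) :
    rk M (X ∩ Y) + rk M (X ∪ Y) ≤ rk M X + rk M Y := by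
  have := M.eRk_inter_add_eRk_union_le X Y
  simp only [← coe_rk] at this
  exact_mod_cast this

theorem rk_le_ncard (X : Set E) : rk M X ≤ X.ncard := by
  have := M.eRk_le_encard X
  rw [← coe_rk, ← X.toFinite.cast_ncard_eq] at this
  exact_mod_cast this

variable {M}

theorem ncard_le_rk {I X : Set E} (hI : M.Indep I) (hIX : I ⊆ X) : I.ncard ≤ rk M X := by
  have := hI.encard_le_eRk_of_subset hIX
  rw [← coe_rk, ← I.toFinite.cast_ncard_eq] at this
  exact_mod_cast this

theorem indep_of_ncard_le_rk {I : Set E} (h : I.ncard ≤ rk M I) : M.Indep I := by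
  refine (M.isRkFinite_of_finite I.toFinite).indep_of_encard_le_eRk ?_
  rw [← coe_rk, ← I.toFinite.cast_ncard_eq]
  exact_mod_cast h

theorem rk_le_ncard_isBase {B : Set E} (hB : M.IsBase B) (X : Set E) : rk M X ≤ B.ncard := by
  have := M.eRk_le_eRank X
  rw [← hB.encard_eq_eRank, ← coe_rk, ← B.toFinite.cast_ncard_eq] at this
  exact_mod_cast this

theorem isBase_of_ncard_le {I B : Set E} (hI : M.Indep I) (hB : M.IsBase B)
    (h : B.ncard ≤ I.ncard) : M.IsBase I := by
  refine hI.isBase_of_eRk_ge I.toFinite ?_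
  rw [hI.eRk_eq_encard, ← hB.encard_eq_eRank, ← I.toFinite.cast_ncard_eq,
    ← B.toFinite.cast_ncard_eq]
  exact_mod_cast h

end Rank

/-- Rado's theorem. A minimal family satisfying the rank condition consists of singletons: if deleting
`x` and deleting `y` from the same member both violated the condition, submodularity of the rank
would contradict it for the family itself. -/
theorem exists_indep_transversal {E ι : Type*} [Finite E] [Fintype ι] (M : Matroid E)
    (𝒜 : ι → Finset E) (h : ∀ J : Finset ι, J.card ≤ rk M (⋃ i ∈ J, (𝒜 i : Set E))) :
    ∃ f : ι → E, (∀ i, f i ∈ 𝒜 i) ∧ f.Injective ∧ M.Indep (Set.range f) := by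
  classical
  induction hN : ∑ i, (𝒜 i).card using Nat.strong_induction_on generalizing 𝒜 with
  | _ N ih =>
  subst hN
  by_cases hall : ∀ i, (𝒜 i).card ≤ 1
  · have hone : ∀ i, (𝒜 i).card = 1 := fun i => by
      refine le_antisymm (hall i) ?_
      have := (h {i}).trans (rk_le_ncard M _)
      simpa using this
    choose f hf using fun i => Finset.card_eq_one.1 (hone i)
    have hU : (⋃ i ∈ (Finset.univ : Finset ι), (𝒜 i : Set E)) = Set.range f := by
      ext e; simp [hf, eq_comm]
    have h1 := h Finset.univ
    rw [hU, Finset.card_univ] at h1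
    have h2 := rk_le_ncard M (Set.range f)
    have himg : (Set.range f).ncard = (Finset.univ.image f).card := by
      rw [← Set.ncard_coe_finset]; simp
    have h3 : (Finset.univ.image f).card = Fintype.card ι :=
      le_antisymm Finset.card_image_le (by omega)
    refine ⟨f, fun i => by simp [hf], ?_, ?_⟩
    · rw [← Set.injOn_univ, ← Finset.coe_univ]
      exact Finset.card_image_iff.1 h3
    · exact indep_of_ncard_le_rk (by omega)
  · push Not at hall
    obtain ⟨i, hi⟩ := hall
    obtain ⟨x, hx, y, hy, hxy⟩ := Finset.one_lt_card.1 hi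
    -- it suffices to delete one element of `𝒜 i` while keeping the rank condition
    have key : ∀ v ∈ 𝒜 i,
        (∀ J : Finset ι, i ∉ J → J.card + 1 ≤
          rk M ((𝒜 i \ {v} : Set E) ∪ ⋃ j ∈ J, (𝒜 j : Set E))) →
        ∃ f : ι → E, (∀ i, f i ∈ 𝒜 i) ∧ f.Injective ∧ M.Indep (Set.range f) := by
      intro v hv hJ
      obtain ⟨f, hf, hinj, hind⟩ := ih (∑ j, (Function.update 𝒜 i ((𝒜 i).erase v) j).card) (by
        refine Finset.sum_lt_sum (fun j _ => ?_) ⟨i, Finset.mem_univ _, ?_⟩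
        · by_cases hji : j = i
          · subst hji; simpa using Finset.card_erase_le
          · simp [hji]
        · simpa using Finset.card_erase_lt_of_mem hv) (Function.update 𝒜 i ((𝒜 i).erase v)) (by
        intro J
        by_cases hiJ : i ∈ J
        · have h1 := hJ (J.erase i) (Finset.notMem_erase _ _)
          rw [Finset.card_erase_add_one hiJ] at h1
          refine h1.trans (rk_mono M ?_)
          refine Set.union_subset ?_ ?_
          · refine Set.subset_iUnion₂_of_subset i hiJ ?_
            simp
          · refine Set.iUnion₂_subset fun j hj => ?_
            refine Set.subset_iUnion₂_of_subset j (Finset.mem_of_mem_erase hj) ?_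
            simp [Finset.ne_of_mem_erase hj]
        · refine (h J).trans (rk_mono M ?_)
          refine Set.iUnion₂_subset fun j hj => ?_
          refine Set.subset_iUnion₂_of_subset j hj ?_
          have : j ≠ i := fun h => hiJ (h ▸ hj)
          simp [this]) rfl
      refine ⟨f, fun j => ?_, hinj, hind⟩
      have := hf j
      by_cases hji : j = i
      · subst hji
        simp at this
        exact this.2
      · simpa [hji] using this
    by_contra hcon
    have hx' := mt (key x hx) hcon
    have hy' := mt (key y hy) hcon
    push Not at hx' hy'
    obtain ⟨J, hiJ, hJ⟩ := hx'
    obtain ⟨L, hiL, hL⟩ := hy'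
    have hsub := rk_inter_add_rk_union_le M ((𝒜 i \ {x} : Set E) ∪ ⋃ j ∈ J, (𝒜 j : Set E))
      ((𝒜 i \ {y} : Set E) ∪ ⋃ j ∈ L, (𝒜 j : Set E))
    have h1 := (h (J ∩ L)).trans (rk_mono M (Y := ((𝒜 i \ {x} : Set E) ∪ ⋃ j ∈ J, (𝒜 j : Set E)) ∩
      ((𝒜 i \ {y} : Set E) ∪ ⋃ j ∈ L, (𝒜 j : Set E))) (by
        refine Set.iUnion₂_subset fun j hj => Set.subset_inter ?_ ?_
        · exact (Set.subset_biUnion_of_mem (u := fun j => (𝒜 j : Set E))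
            (Finset.mem_coe.2 (Finset.mem_inter.1 hj).1)).trans Set.subset_union_right
        · exact (Set.subset_biUnion_of_mem (u := fun j => (𝒜 j : Set E))
            (Finset.mem_coe.2 (Finset.mem_inter.1 hj).2)).trans Set.subset_union_right))
    have h2 := (h (insert i (J ∪ L))).trans (rk_mono M
      (Y := ((𝒜 i \ {x} : Set E) ∪ ⋃ j ∈ J, (𝒜 j : Set E)) ∪
      ((𝒜 i \ {y} : Set E) ∪ ⋃ j ∈ L, (𝒜 j : Set E))) (by
        intro e he
        simp only [Set.mem_iUnion, Finset.mem_insert, Finset.mem_union, exists_prop] at he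
        simp only [Set.mem_union, Set.mem_sdiff, Set.mem_singleton_iff, Set.mem_iUnion, exists_prop]
        obtain ⟨j, rfl | hj | hj, he⟩ := he
        · by_cases hex : e = x
          · subst hex; exact Or.inr (Or.inl ⟨he, hxy⟩)
          · exact Or.inl (Or.inl ⟨he, hex⟩)
        · exact Or.inl (Or.inr ⟨j, hj, he⟩)
        · exact Or.inr (Or.inr ⟨j, hj, he⟩)))
    rw [Finset.card_insert_of_notMem (by simp [hiJ, hiL])] at h2
    have h3 := Finset.card_union_add_card_inter J L
    omega

/-- Rado's theorem for the classes of a partition `τ` of `S`, the class of `x` being repeated `c x`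
times: the integer points of the polymatroid obtained by aggregating the classes are realized by
independent sets. -/
theorem exists_indep_of_counts {E ι : Type*} [Fintype E] [Fintype ι] [DecidableEq ι]
    (M : Matroid E) (S : Finset E) (τ : E → ι) (c : ι → ℕ)
    (h : ∀ X : Finset ι, ∑ x ∈ X, c x ≤ rk M {e | e ∈ S ∧ τ e ∈ X}) :
    ∃ I : Finset E, I ⊆ S ∧ M.Indep I ∧ ∀ x, (I.filter fun e => τ e = x).card = c x := by
  classical
  obtain ⟨f, hf, hinj, hind⟩ := exists_indep_transversal (ι := Σ x, Fin (c x)) M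
    (fun a => S.filter fun e => τ e = a.1) (by
      intro J
      refine le_trans ?_ ((h (J.image Sigma.fst)).trans (rk_mono M ?_))
      · refine (Finset.card_le_card (t := (J.image Sigma.fst).sigma fun _ => Finset.univ) ?_).trans
          ?_
        · intro a ha
          simpa using ⟨a.2, ha⟩
        · simp
      · rintro e ⟨heS, heJ⟩
        obtain ⟨a, ha, hae⟩ := Finset.mem_image.1 heJ
        simp only [Set.mem_iUnion, Finset.coe_filter, exists_prop]
        exact ⟨a, ha, heS, hae.symm⟩)
  simp only [Finset.mem_filter] at hf
  refine ⟨Finset.univ.image f, ?_, by simpa using hind, fun x => ?_⟩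
  · intro e he
    obtain ⟨a, -, rfl⟩ := Finset.mem_image.1 he
    exact (hf a).1
  · rw [Finset.filter_image, Finset.card_image_of_injective _ hinj]
    simp only [(hf _).2]
    have : (Finset.univ.filter fun a : Σ x, Fin (c x) => a.1 = x) =
        Finset.univ.map ⟨fun i : Fin (c x) => (⟨x, i⟩ : Σ x, Fin (c x)), fun i j hij => by
          simpa using hij⟩ := by
      ext ⟨y, i⟩
      simp only [Finset.mem_filter, Finset.mem_univ, true_and, Finset.mem_map]
      constructor
      · rintro rfl; exact ⟨i, rfl⟩
      · rintro ⟨j, hj⟩; exact (congrArg Sigma.fst hj).symm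
    rw [this]
    simp

/-! ### Uncrossing and matchings between types -/

section Submodular

variable {ι : Type*} [DecidableEq ι] {f : Finset ι → ℤ}

/-- A nonnegative submodular function vanishing at `∅` is subadditive under unions. -/
theorem submodular_sup_le (h0 : ∀ X, 0 ≤ f X) (hbot : f ∅ = 0)
    (hsub : ∀ X Y, f (X ∩ Y) + f (X ∪ Y) ≤ f X + f Y) {κ : Type*} (T : Finset κ)
    (g : κ → Finset ι) : f (T.sup g) ≤ ∑ t ∈ T, f (g t) := by
  classical
  induction T using Finset.induction_on with
  | empty => simp [hbot]
  | insert t T ht ih =>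
    rw [Finset.sup_insert, Finset.sum_insert ht, Finset.sup_eq_union]
    linarith [hsub (g t) (T.sup g), h0 (g t ∩ T.sup g)]

/-- A nonnegative submodular function vanishing at the whole set is subadditive under
intersections. -/
theorem submodular_inf_le [Fintype ι] (h0 : ∀ X, 0 ≤ f X) (htop : f Finset.univ = 0)
    (hsub : ∀ X Y, f (X ∩ Y) + f (X ∪ Y) ≤ f X + f Y) {κ : Type*} (T : Finset κ)
    (g : κ → Finset ι) : f (T.inf g) ≤ ∑ t ∈ T, f (g t) := by
  classical
  induction T using Finset.induction_on with
  | empty => simp [htop]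
  | insert t T ht ih =>
    rw [Finset.inf_insert, Finset.sum_insert ht, Finset.inf_eq_inter]
    linarith [hsub (g t) (T.inf g), h0 (g t ∪ T.inf g)]

/-- Uncrossing: if every pair in `P × Q` is separated by a set of small value, then `P` and `Q` are
separated by a single set of small value. -/
theorem exists_separating_of_forall_pair [Fintype ι] (h0 : ∀ X, 0 ≤ f X) (hbot : f ∅ = 0)
    (htop : f Finset.univ = 0) (hsub : ∀ X Y, f (X ∩ Y) + f (X ∪ Y) ≤ f X + f Y) (K : ℕ)
    (P Q : Finset ι) (h : ∀ s ∈ P, ∀ t ∈ Q, ∃ X, s ∈ X ∧ t ∉ X ∧ f X ≤ K) :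
    ∃ X, P ⊆ X ∧ Disjoint X Q ∧ f X ≤ K * (P.card * Q.card) := by
  choose! g hs ht hK using h
  refine ⟨P.sup fun s => Q.inf fun t => g s t, fun s hsP => ?_, ?_, ?_⟩
  · rw [Finset.mem_sup]
    refine ⟨s, hsP, ?_⟩
    rw [Finset.mem_inf]
    exact fun t htQ => hs s hsP t htQ
  · rw [Finset.disjoint_left]
    intro t htX htQ
    obtain ⟨s, hsP, hst⟩ := Finset.mem_sup.1 htX
    exact ht s hsP t htQ (Finset.mem_inf.1 hst t htQ)
  · calc f (P.sup fun s => Q.inf fun t => g s t)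
        ≤ ∑ s ∈ P, f (Q.inf fun t => g s t) := submodular_sup_le h0 hbot hsub _ _
      _ ≤ ∑ s ∈ P, ∑ t ∈ Q, f (g s t) :=
          Finset.sum_le_sum fun s _ => submodular_inf_le h0 htop hsub _ _
      _ ≤ ∑ s ∈ P, ∑ t ∈ Q, (K : ℤ) :=
          Finset.sum_le_sum fun s hsP => Finset.sum_le_sum fun t htQ => hK s hsP t htQ
      _ = K * (P.card * Q.card) := by simp; ring

end Submodular

/-- The deficiency version of Hall's theorem, obtained by adding `D` elements adjacent to
everything. -/
theorem exists_matching_of_card_le_add {ι α : Type*} [DecidableEq α] (S : Finset ι)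
    (t : ι → Finset α) (D : ℕ) (h : ∀ s ⊆ S, s.card ≤ (s.biUnion t).card + D) :
    ∃ (I : Finset ι) (φ : I → α), I ⊆ S ∧ φ.Injective ∧ (∀ i : I, φ i ∈ t i) ∧
      S.card ≤ I.card + D := by
  classical
  obtain ⟨F, hF, hFt⟩ := (Finset.all_card_le_biUnion_card_iff_exists_injective
    fun i : S => (t i).disjSum (Finset.univ : Finset (Fin D))).1 (by
      intro s
      rcases s.eq_empty_or_nonempty with rfl | ⟨i, hi⟩
      · simp
      · have hsub : ((s.map (Function.Embedding.subtype _)).biUnion t).disjSum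
            (Finset.univ : Finset (Fin D)) ⊆
            s.biUnion fun i : S => (t i).disjSum (Finset.univ : Finset (Fin D)) := by
          rintro (a | a) ha
          · simpa using ha
          · simpa using ⟨i, i.2, hi⟩
        have h1 := Finset.card_le_card hsub
        rw [Finset.card_disjSum, Finset.card_univ, Fintype.card_fin] at h1
        have h2 := h (s.map (Function.Embedding.subtype _)) fun e he => by
          obtain ⟨v, -, rfl⟩ := Finset.mem_map.1 he
          exact v.2
        rw [Finset.card_map] at h2
        exact h2.trans h1)
  have hI : ∀ i : (Finset.univ.filter fun i => (F i).isLeft).map (Function.Embedding.subtype _),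
      ∃ (j : S) (a : α), (j : ι) = i ∧ F j = Sum.inl a := by
    rintro ⟨i, hi⟩
    obtain ⟨j, hj, rfl⟩ := Finset.mem_map.1 hi
    obtain ⟨a, ha⟩ := Sum.isLeft_iff.1 (Finset.mem_filter.1 hj).2
    exact ⟨j, a, rfl, ha⟩
  choose g φ hg hφ using hI
  refine ⟨_, φ, fun e he => ?_, fun i j hij => ?_, fun i => ?_, ?_⟩
  · obtain ⟨v, -, rfl⟩ := Finset.mem_map.1 he
    exact v.2
  · have h1 : F (g i) = F (g j) := by rw [hφ, hφ, hij]
    exact Subtype.ext (by rw [← hg i, ← hg j, hF h1])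
  · have := hFt (g i)
    rw [hφ, Finset.inl_mem_disjSum, hg] at this
    exact this
  · have h1 : (Finset.univ.filter fun i => ¬ (F i).isLeft).card ≤ D := by
      have h2 : ((Finset.univ.filter fun i => ¬ (F i).isLeft).image F).card ≤
          ((Finset.univ : Finset (Fin D)).map
            (Function.Embedding.inr : Fin D ↪ α ⊕ Fin D)).card := by
        refine Finset.card_le_card fun b hb => ?_
        obtain ⟨i, hi, rfl⟩ := Finset.mem_image.1 hb
        have hi := (Finset.mem_filter.1 hi).2
        cases hFi : F i with
        | inl a => simp [hFi] at hi
        | inr a => simp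
      rwa [Finset.card_image_of_injective _ hF, Finset.card_map, Finset.card_univ,
        Fintype.card_fin] at h2
    have h2 := Finset.card_filter_add_card_filter_not (s := (Finset.univ : Finset S))
      fun i => (F i).isLeft
    rw [Finset.card_univ, Fintype.card_coe] at h2
    rw [Finset.card_map]
    omega

section Slack

variable {E ι : Type*} [Fintype E] [DecidableEq ι] {M : Matroid E} {A B S : Finset E}
  {ty : E → ι}

/-- The slack of the rank constraint at the basis `A` for a set `X` of types: the rank of the set of
elements of `S` with type in `X`, minus the number of elements of `A` with type in `X`. It is meant
for `A ⊆ S`, where it is nonnegative, and takes values in `ℤ` so that subtraction is not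
truncated. -/
noncomputable def slack (M : Matroid E) (A S : Finset E) (ty : E → ι) (X : Finset ι) : ℤ :=
  rk M {e | e ∈ S ∧ ty e ∈ X} - (A.filter fun e => ty e ∈ X).card

theorem slack_nonneg (hA : M.Indep (A : Set E)) (hAS : A ⊆ S) (X : Finset ι) :
    0 ≤ slack M A S ty X := by
  have := ncard_le_rk (M := M) (I := (A.filter fun e => ty e ∈ X : Finset E))
    (X := {e | e ∈ S ∧ ty e ∈ X}) (hA.subset (Finset.coe_subset.2 (Finset.filter_subset _ _))) (fun e he => by
      have := Finset.mem_filter.1 (Finset.mem_coe.1 he)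
      exact ⟨hAS this.1, this.2⟩)
  rw [Set.ncard_coe_finset] at this
  simp only [slack]
  omega

theorem slack_empty : slack M A S ty ∅ = 0 := by
  have := rk_le_ncard M (∅ : Set E)
  simp only [Set.ncard_empty, Nat.le_zero] at this
  simp [slack, this]

theorem slack_univ [Fintype ι] (hA : M.IsBase (A : Set E)) (hAS : A ⊆ S) :
    slack M A S ty Finset.univ = 0 := by
  have h1 := slack_nonneg (ty := ty) hA.indep hAS Finset.univ
  have h2 := rk_le_ncard_isBase hA {e | e ∈ S ∧ ty e ∈ (Finset.univ : Finset ι)}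
  rw [Set.ncard_coe_finset] at h2
  simp only [slack, Finset.mem_univ, Finset.filter_true] at h1 h2 ⊢
  omega

theorem slack_inter_add_slack_union_le (X Y : Finset ι) :
    slack M A S ty (X ∩ Y) + slack M A S ty (X ∪ Y) ≤ slack M A S ty X + slack M A S ty Y := by
  classical
  have h1 := rk_inter_add_rk_union_le M {e | e ∈ S ∧ ty e ∈ X} {e | e ∈ S ∧ ty e ∈ Y}
  have h2 : {e | e ∈ S ∧ ty e ∈ X} ∩ {e | e ∈ S ∧ ty e ∈ Y} = {e | e ∈ S ∧ ty e ∈ X ∩ Y} := by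
    ext e; simp; tauto
  have h3 : {e | e ∈ S ∧ ty e ∈ X} ∪ {e | e ∈ S ∧ ty e ∈ Y} = {e | e ∈ S ∧ ty e ∈ X ∪ Y} := by
    ext e; simp; tauto
  rw [h2, h3] at h1
  have h4 := Finset.card_inter_add_card_union (A.filter fun e => ty e ∈ X)
    (A.filter fun e => ty e ∈ Y)
  rw [← Finset.filter_and, ← Finset.filter_or] at h4
  simp only [slack, Finset.mem_inter, Finset.mem_union] at h1 ⊢
  omega

/-- All but `K * p ^ 2` elements of `B` can be matched to elements of `A` such that the type of an
element and the type of its partner are only separated by sets of slack at least `K`. If Hall's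
condition failed for `s ⊆ B`, uncrossing would give a set `X` of types of slack at most `K * p ^ 2`
that contains the types of `s` and, among elements of `A`, only types of neighbours of `s`; the
rank of the independent set `s` would be too large. -/
theorem exists_matching_of_isBase [Fintype ι] [DecidableEq E] (hA : M.IsBase (A : Set E))
    (hB : M.IsBase (B : Set E)) (K p : ℕ) (hpA : (A.image ty).card ≤ p)
    (hpB : (B.image ty).card ≤ p) :
    ∃ (I : Finset E) (φ : I → E), I ⊆ B ∧ φ.Injective ∧ (∀ i, φ i ∈ A) ∧
      (∀ (i : I) X, ty i ∈ X → ty (φ i) ∉ X → K ≤ slack M A (A ∪ B) ty X) ∧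
      B.card ≤ I.card + K * p ^ 2 := by
  classical
  obtain ⟨I, φ, hIB, hinj, hφ, hcard⟩ := exists_matching_of_card_le_add B
    (fun v => A.filter fun u => ∀ X, ty v ∈ X → ty u ∉ X → K ≤ slack M A (A ∪ B) ty X)
    (K * p ^ 2) (by
      intro s hsB
      set N := s.biUnion
        fun v => A.filter fun u => ∀ X, ty v ∈ X → ty u ∉ X → K ≤ slack M A (A ∪ B) ty X
      obtain ⟨X, hPX, hXQ, hX⟩ := exists_separating_of_forall_pair
        (f := slack M A (A ∪ B) ty) (slack_nonneg hA.indep Finset.subset_union_left) slack_empty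
        (slack_univ hA Finset.subset_union_left) slack_inter_add_slack_union_le K
        (s.image ty) ((A \ N).image ty) (by
          intro x hx t ht
          obtain ⟨v, hv, rfl⟩ := Finset.mem_image.1 hx
          obtain ⟨u, hu, rfl⟩ := Finset.mem_image.1 ht
          rw [Finset.mem_sdiff] at hu
          by_contra! hcon
          exact hu.2 (Finset.mem_biUnion.2
            ⟨v, hv, Finset.mem_filter.2 ⟨hu.1, fun X h1 h2 => (hcon X h1 h2).le⟩⟩))
      have h1 : (s.image ty).card ≤ p :=
        (Finset.card_le_card (Finset.image_subset_image hsB)).trans hpB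
      have h2 : ((A \ N).image ty).card ≤ p :=
        (Finset.card_le_card (Finset.image_subset_image Finset.sdiff_subset)).trans hpA
      have h3 : (s.image ty).card * ((A \ N).image ty).card ≤ p ^ 2 := by
        rw [sq]; exact Nat.mul_le_mul h1 h2
      have h4 : slack M A (A ∪ B) ty X ≤ (K * p ^ 2 : ℕ) := by
        refine hX.trans ?_
        exact_mod_cast Nat.mul_le_mul_left K h3
      have h5 : (A.filter fun e => ty e ∈ X).card ≤ N.card := by
        refine Finset.card_le_card fun u hu => ?_
        rw [Finset.mem_filter] at hu
        by_contra huN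
        exact Finset.disjoint_left.1 hXQ hu.2
          (Finset.mem_image_of_mem _ (Finset.mem_sdiff.2 ⟨hu.1, huN⟩))
      have h6 := ncard_le_rk (M := M) (I := (s : Set E))
        (X := {e | e ∈ A ∪ B ∧ ty e ∈ X}) (hB.indep.subset (Finset.coe_subset.2 hsB))
        fun e he => ⟨Finset.mem_union_right _ (hsB he), hPX (Finset.mem_image_of_mem ty he)⟩
      rw [Set.ncard_coe_finset] at h6
      simp only [slack] at h4
      omega)
  exact ⟨I, φ, hIB, hinj, fun i => (Finset.mem_filter.1 (hφ i)).1,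
    fun i => (Finset.mem_filter.1 (hφ i)).2, hcard⟩

/-- A change `d` of the type counts of `A` that respects all slacks is realized by a basis. -/
theorem exists_isBase_of_slack [Fintype ι] [DecidableEq E] (hA : M.IsBase (A : Set E))
    (d : ι → ℤ) (hd0 : ∑ x, d x = 0) (hd : ∀ X, ∑ x ∈ X, d x ≤ slack M A S ty X) :
    ∃ I : Finset E, I ⊆ S ∧ M.IsBase (I : Set E) ∧
      ∀ x, ((I.filter fun e => ty e = x).card : ℤ) = (A.filter fun e => ty e = x).card + d x := by
  classical
  let c : ι → ℤ := fun x => (A.filter fun e => ty e = x).card + d x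
  have hA' : ∀ X : Finset ι, ∑ x ∈ X, ((A.filter fun e => ty e = x).card : ℤ) =
      (A.filter fun e => ty e ∈ X).card := fun X => by
    rw [Finset.card_eq_sum_card_fiberwise (s := A.filter fun e => ty e ∈ X) (f := ty) (t := X)
      (fun e he => (Finset.mem_filter.1 he).2)]
    push_cast
    refine Finset.sum_congr rfl fun x hx => ?_
    rw [Finset.filter_filter]
    congr 2
    ext e
    simp only [Finset.mem_filter]
    constructor
    · rintro ⟨h1, rfl⟩; exact ⟨h1, hx, rfl⟩
    · rintro ⟨h1, -, h2⟩; exact ⟨h1, h2⟩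
  have hc : ∀ X : Finset ι, ∑ x ∈ X, c x ≤ rk M {e | e ∈ S ∧ ty e ∈ X} := fun X => by
    have := hd X
    simp only [slack] at this
    simp only [c, Finset.sum_add_distrib, hA']
    linarith
  have hcuniv : ∑ x, c x = A.card := by
    simp only [c, Finset.sum_add_distrib, hA', hd0]
    simp
  -- the rank constraint for the complement of `{x}` bounds the count of `x` from below
  have hc0 : ∀ x, 0 ≤ c x := fun x => by
    have h1 := hc (Finset.univ.erase x)
    have h2 := rk_le_ncard_isBase hA {e | e ∈ S ∧ ty e ∈ Finset.univ.erase x}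
    rw [Set.ncard_coe_finset] at h2
    have h3 := Finset.add_sum_erase Finset.univ c (Finset.mem_univ x)
    omega
  obtain ⟨I, hIS, hI, hIc⟩ := exists_indep_of_counts M S ty (fun x => (c x).toNat) (fun X => by
    have := hc X
    zify
    simpa [max_eq_left (hc0 _)] using this)
  have hIc' : ∀ x, ((I.filter fun e => ty e = x).card : ℤ) = c x := fun x => by
    rw [hIc, Int.toNat_of_nonneg (hc0 x)]
  refine ⟨I, hIS, isBase_of_ncard_le hI hA ?_, hIc'⟩
  rw [Set.ncard_coe_finset, Set.ncard_coe_finset]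
  have : (I.card : ℤ) = A.card := by
    rw [Finset.card_eq_sum_card_fiberwise (s := I) (f := ty) (t := Finset.univ)
      (fun e _ => Finset.mem_univ _), ← hcuniv]
    push_cast
    exact Finset.sum_congr rfl fun x _ => hIc' x
  omega

end Slack

/-! ### Replacing a basis by one closer to a target -/

/-- If two disjoint bases `A`, `B` of almost the same weight are large, then some basis other than `A`
inside `A ∪ B` has the weight of `A`. A short relation between the weight differences along the
matched pairs is a change of type counts of weight zero. It uses at most `K` pairs, and these are
separated only by sets of slack at least `K`, so it respects every slack. -/
theorem exists_isBase_of_disjoint {E ι : Type*} [Fintype E] [DecidableEq E] [Fintype ι]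
    [DecidableEq ι] {M : Matroid E} {A B : Finset E} (hA : M.IsBase (A : Set E))
    (hB : M.IsBase (B : Set E)) (ty : E → ι) (hsep : ∀ a ∈ A, ∀ b ∈ B, ty a ≠ ty b)
    {m : ℕ} (w : ι → Fin m → ℤ) (Δ p R K : ℕ) (hw : ∀ x k, |w x k| ≤ Δ)
    (hpA : (A.image ty).card ≤ p) (hpB : (B.image ty).card ≤ p)
    (hR : ∀ k, |∑ e ∈ B, w (ty e) k - ∑ e ∈ A, w (ty e) k| ≤ R)
    (hK : K = (m + 1) * (2 * (m * (2 * Δ)) + 1) ^ m)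
    (hn : K * p ^ 2 + K * (R + 2 * Δ * (K * p ^ 2)) < A.card) :
    ∃ I ⊆ A ∪ B, M.IsBase (I : Set E) ∧ (∀ k, ∑ e ∈ I, w (ty e) k = ∑ e ∈ A, w (ty e) k) ∧
      ∃ e ∈ I, e ∈ B := by
  have hcard : B.card = A.card := by
    have := hB.ncard_eq_ncard_of_isBase hA
    simpa using this
  obtain ⟨I, φ, hIB, hinj, hφA, hφ, hIcard⟩ := exists_matching_of_isBase hA hB K p hpA hpB
  set D := K * p ^ 2
  have hIpos : K * (R + 2 * Δ * D) < I.card := by omega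
  have : Nonempty I := by
    obtain ⟨e, he⟩ := Finset.card_pos.1 (by omega : 0 < I.card)
    exact ⟨⟨e, he⟩⟩
  let ρ : I → Fin m → ℤ := fun v k => w (ty v) k - w (ty (φ v)) k
  have hρ : ∀ v k, |ρ v k| ≤ (2 * Δ : ℕ) := fun v k => by
    have h1 := hw (ty v) k
    have h2 := hw (ty (φ v)) k
    have h3 := abs_sub (w (ty v) k) (w (ty (φ v)) k)
    push_cast
    simp only [ρ]
    omega
  have hbound : ∀ (s : Finset E) k, s.card ≤ D → |∑ e ∈ s, w (ty e) k| ≤ Δ * D := by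
    intro s k hs
    refine (Finset.abs_sum_le_sum_abs _ _).trans
      ((Finset.sum_le_card_nsmul _ _ (Δ : ℤ) fun e _ => hw _ k).trans ?_)
    rw [nsmul_eq_mul, mul_comm]
    exact mul_le_mul_of_nonneg_left (by exact_mod_cast hs) (by positivity)
  let J : Finset E := Finset.univ.image φ
  have hJA : J ⊆ A := fun e he => by
    obtain ⟨v, -, rfl⟩ := Finset.mem_image.1 he
    exact hφA v
  have hJcard : J.card = I.card := by
    rw [Finset.card_image_of_injective _ hinj, Finset.card_univ, Fintype.card_coe]
  have hρsum : ∀ k, |∑ v, ρ v k| ≤ (R + 2 * Δ * D : ℕ) := fun k => by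
    have h1 : ∑ v, ρ v k = ∑ e ∈ I, w (ty e) k - ∑ e ∈ J, w (ty e) k := by
      simp only [ρ, Finset.sum_sub_distrib, J]
      rw [Finset.sum_image fun _ _ _ _ h => hinj h, ← Finset.sum_coe_sort I]
    have h2 := Finset.sum_sdiff (f := fun e => w (ty e) k) hIB
    have h3 := Finset.sum_sdiff (f := fun e => w (ty e) k) hJA
    have h4 := hbound (B \ I) k (by rw [Finset.card_sdiff_of_subset hIB]; omega)
    have h5 := hbound (A \ J) k (by rw [Finset.card_sdiff_of_subset hJA]; omega)
    have h6 := hR k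
    push_cast
    rw [abs_le] at *
    rw [h1]
    constructor <;> linarith
  obtain ⟨z, hz0, hzK, hz⟩ := exists_zero_sum_combination ρ (2 * Δ) hρ (fun k => by
    rw [← hK, Fintype.card_coe]
    refine lt_of_le_of_lt (mul_le_mul_of_nonneg_left (hρsum k) (by positivity)) ?_
    exact_mod_cast hIpos)
  rw [← hK] at hzK
  let d : ι → ℤ := fun x =>
    ∑ v, (z v : ℤ) * ((if ty v = x then 1 else 0) - if ty (φ v) = x then 1 else 0)
  have hdX : ∀ X : Finset ι, ∑ x ∈ X, d x =
      ∑ v, (z v : ℤ) * ((if ty v ∈ X then 1 else 0) - if ty (φ v) ∈ X then 1 else 0) := by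
    intro X
    simp only [d]
    rw [Finset.sum_comm]
    refine Finset.sum_congr rfl fun v _ => ?_
    rw [← Finset.mul_sum, Finset.sum_sub_distrib, Finset.sum_ite_eq, Finset.sum_ite_eq]
  obtain ⟨I', hI'S, hI', hI'c⟩ := exists_isBase_of_slack (S := A ∪ B) (ty := ty) hA d
    (by rw [hdX]; simp) (by
      intro X
      rw [hdX]
      -- either `X` separates a matched pair and has slack `K`, or no pair increases the count of `X`
      by_cases hX : ∃ v : I, ty v ∈ X ∧ ty (φ v) ∉ X
      · obtain ⟨v, hv1, hv2⟩ := hX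
        refine le_trans ?_ (hφ v X hv1 hv2)
        refine le_trans (Finset.sum_le_sum (g := fun v => (z v : ℤ)) fun v _ => ?_)
          (by exact_mod_cast hzK)
        have : ((if ty v ∈ X then 1 else 0) - if ty (φ v) ∈ X then 1 else 0 : ℤ) ≤ 1 := by
          split_ifs <;> simp
        nlinarith
      · push Not at hX
        refine le_trans (Finset.sum_nonpos fun v _ => ?_)
          (slack_nonneg hA.indep Finset.subset_union_left X)
        have : ((if ty v ∈ X then 1 else 0) - if ty (φ v) ∈ X then 1 else 0 : ℤ) ≤ 0 := by
          by_cases h : ty v ∈ X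
          · simp [h, hX v h]
          · simp only [h, if_false]; split_ifs <;> simp
        nlinarith)
  have hfib : ∀ (T : Finset E) k,
      ∑ e ∈ T, w (ty e) k = ∑ x, ((T.filter fun e => ty e = x).card : ℤ) * w x k := by
    intro T k
    rw [← Finset.sum_fiberwise T ty]
    refine Finset.sum_congr rfl fun x _ => ?_
    rw [Finset.sum_congr rfl (g := fun _ => w x k) fun e he => by
      rw [(Finset.mem_filter.1 he).2]]
    simp
  refine ⟨I', hI'S, hI', fun k => ?_, ?_⟩
  · rw [hfib, hfib]
    simp only [hI'c, add_mul, Finset.sum_add_distrib]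
    rw [add_eq_left, ← hz k]
    simp only [d, Finset.sum_mul, ρ]
    rw [Finset.sum_comm]
    refine Finset.sum_congr rfl fun v _ => ?_
    simp only [mul_assoc, ← Finset.mul_sum, sub_mul, Finset.sum_sub_distrib, ite_mul, one_mul,
      zero_mul, Finset.sum_ite_eq, Finset.mem_univ, if_true]
  · obtain ⟨v, hv⟩ : ∃ v, z v ≠ 0 := by
      by_contra! h
      exact hz0 (funext h)
    have h1 : 0 < d (ty v) := by
      refine Finset.sum_pos' (fun u _ => ?_) ⟨v, Finset.mem_univ _, ?_⟩
      · rw [if_neg (hsep _ (hφA u) _ (hIB v.2))]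
        split_ifs <;> simp
      · rw [if_neg (hsep _ (hφA v) _ (hIB v.2))]
        simp
        omega
    have h2 := hI'c (ty v)
    obtain ⟨e, he⟩ := Finset.card_pos.1 (by omega : 0 < (I'.filter fun e => ty e = ty v).card)
    rw [Finset.mem_filter] at he
    refine ⟨e, he.1, ?_⟩
    rcases Finset.mem_union.1 (hI'S he.1) with h | h
    · exact absurd he.2 (hsep e h v (hIB v.2))
    · exact h

/-- If `B` has almost the weight of `A` and `A \ B` is large, then `A` can be replaced by a basis of the
same weight with fewer elements outside `B`. This is the case of disjoint bases, applied to the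
contraction of `A ∩ B`. -/
theorem exists_isBase_card_sdiff_lt {E : Type*} [Fintype E] [DecidableEq E] {M : Matroid E}
    {A B : Finset E} (hA : M.IsBase (A : Set E)) (hB : M.IsBase (B : Set E)) {m : ℕ}
    (W : Matrix (Fin m) E ℤ) (Δ R K : ℕ) (hW : ∀ k e, |W k e| ≤ Δ)
    (hR : ∀ k, |∑ e ∈ B, W k e - ∑ e ∈ A, W k e| ≤ R)
    (hK : K = (m + 1) * (2 * (m * (2 * Δ)) + 1) ^ m)
    (hn : K * ((2 * Δ + 1) ^ m) ^ 2 + K * (R + 2 * Δ * (K * ((2 * Δ + 1) ^ m) ^ 2)) <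
      (A \ B).card) :
    ∃ A' : Finset E, M.IsBase (A' : Set E) ∧ (∀ k, ∑ e ∈ A', W k e = ∑ e ∈ A, W k e) ∧
      (A' \ B).card < (A \ B).card := by
  classical
  have hC : M.Indep ((A ∩ B : Finset E) : Set E) :=
    hA.indep.subset (Finset.coe_subset.2 Finset.inter_subset_left)
  have hA' : (M.contract ((A ∩ B : Finset E) : Set E)).IsBase ((A \ B : Finset E) : Set E) := by
    rw [hC.contract_isBase_iff, ← Finset.coe_union, Finset.sdiff_union_inter,
      Finset.disjoint_coe]
    exact ⟨hA, Finset.disjoint_sdiff_inter A B⟩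
  have hB' : (M.contract ((A ∩ B : Finset E) : Set E)).IsBase ((B \ A : Finset E) : Set E) := by
    rw [hC.contract_isBase_iff, ← Finset.coe_union, Finset.inter_comm, Finset.sdiff_union_inter,
      Finset.disjoint_coe]
    exact ⟨hB, Finset.disjoint_sdiff_inter B A⟩
  -- the type of an element records its column and the basis it comes from
  let κ := Fin m → Set.Icc (-(Δ : ℤ)) Δ
  let col : E → κ := fun e k => ⟨W k e, abs_le.1 (hW k e)⟩
  have hκ : Fintype.card κ = (2 * Δ + 1) ^ m := by
    have h1 : ((Δ : ℤ) + 1 - -(Δ : ℤ)).toNat = 2 * Δ + 1 := by omega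
    simp only [κ, Fintype.card_pi, Fintype.card_ofFinset, Int.card_Icc, h1]
    simp
  let ty : E → κ × Bool := fun e => (col e, decide (e ∈ A))
  have himage : ∀ (T : Finset E) (b : Bool), (∀ e ∈ T, decide (e ∈ A) = b) →
      (T.image ty).card ≤ (2 * Δ + 1) ^ m := by
    intro T b hT
    rw [← hκ, ← Finset.card_univ, ← Finset.card_image_of_injective (Finset.univ : Finset κ)
      (f := fun x => (x, b)) (fun x y h => (Prod.ext_iff.1 h).1)]
    refine Finset.card_le_card fun x hx => ?_
    obtain ⟨e, he, rfl⟩ := Finset.mem_image.1 hx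
    exact Finset.mem_image.2 ⟨col e, Finset.mem_univ _, by simp [ty, ← hT e he]⟩
  have hsum : ∀ (S T : Finset E) k, ∑ e ∈ S \ T, W k e + ∑ e ∈ S ∩ T, W k e = ∑ e ∈ S, W k e :=
    fun S T k => by
      rw [← Finset.sum_union (Finset.disjoint_sdiff_inter S T), Finset.sdiff_union_inter]
  obtain ⟨I, hIS, hI, hIW, e, heI, heB⟩ := exists_isBase_of_disjoint hA' hB' ty
    (fun a ha b hb h => by
      have := (Prod.ext_iff.1 h).2
      simp only [ty, decide_eq_decide] at this
      exact (Finset.mem_sdiff.1 hb).2 (this.1 (Finset.mem_sdiff.1 ha).1))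
    (fun x k => (x.1 k : ℤ)) Δ ((2 * Δ + 1) ^ m) R K (fun x k => abs_le.2 (x.1 k).2)
    (himage _ true fun e he => by simpa using (Finset.mem_sdiff.1 he).1)
    (himage _ false fun e he => by simpa using (Finset.mem_sdiff.1 he).2)
    (fun k => by
      have h1 := hsum A B k
      have h2 := hsum B A k
      rw [Finset.inter_comm] at h2
      have h3 : ∑ e ∈ B \ A, W k e - ∑ e ∈ A \ B, W k e = ∑ e ∈ B, W k e - ∑ e ∈ A, W k e := by
        linarith
      simp only [ty, col]
      rw [h3]
      exact hR k) hK hn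
  simp only [ty, col] at hIW
  have hIcard : I.card = (A \ B).card := by
    have := hI.ncard_eq_ncard_of_isBase hA'
    simpa only [Set.ncard_coe_finset] using this
  rw [hC.contract_isBase_iff, ← Finset.coe_union, Finset.disjoint_coe] at hI
  refine ⟨I ∪ (A ∩ B), hI.1, fun k => ?_, ?_⟩
  · rw [Finset.sum_union hI.2, hIW, hsum]
  · rw [← hIcard]
    refine Finset.card_lt_card ⟨fun x hx => ?_, fun h => ?_⟩
    · simp only [Finset.mem_sdiff, Finset.mem_union, Finset.mem_inter] at hx
      tauto
    · exact (Finset.mem_sdiff.1 (h heI)).2 (Finset.mem_sdiff.1 heB).1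

/-! ### Extreme points of slices of the base polytope -/

/-- Symmetric basis exchange. -/
theorem exists_symmetric_exchange {E : Type*} {M : Matroid E} {B B' : Set E} (hB : M.IsBase B)
    (hB' : M.IsBase B') {e : E} (he : e ∈ B \ B') :
    ∃ f ∈ B' \ B, M.IsBase (insert f (B \ {e})) ∧ M.IsBase (insert e (B' \ {f})) := by
  have heE := hB.subset_ground he.1
  have hC := hB'.fundCircuit_isCircuit heE he.2
  obtain ⟨f, hfC, hf⟩ : ∃ f ∈ M.fundCircuit e B' \ {e}, f ∉ M.closure (B \ {e}) := by
    by_contra! hcon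
    have h1 := M.closure_subset_closure_of_subset_closure hcon
    exact hB.indep.notMem_closure_sdiff_of_mem he.1
      (h1 (hC.mem_closure_sdiff_singleton_of_mem (M.mem_fundCircuit e B')))
  have hfB' : f ∈ B' := by
    have := M.fundCircuit_subset_insert e B' hfC.1
    exact this.resolve_left hfC.2
  have hfB : f ∉ B := fun hfB => hf (M.subset_closure (B \ {e})
    (Set.sdiff_subset.trans hB.subset_ground) ⟨hfB, hfC.2⟩)
  refine ⟨f, ⟨hfB', hfB⟩, ?_, ?_⟩
  · exact hB.exchange_base_of_notMem_closure he.1 hf (hB'.subset_ground hfB')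
  · have h1 := (hB'.indep.mem_fundCircuit_iff (by rwa [hB'.closure_eq]) he.2).1 hfC.1
    refine hB'.exchange_isBase_of_indep he.2 ?_
    rwa [Set.insert_sdiff_singleton_comm (Ne.symm hfC.2)]

/-- The space of directions `v` such that `P` contains a segment through `x` in direction `v` with
`x` in its interior. For a polytope this is the direction of the smallest face containing `x`. -/
def lineality {V : Type*} [AddCommGroup V] [Module ℝ V] {P : Set V} (hP : Convex ℝ P) {x : V}
    (hx : x ∈ P) : Submodule ℝ V where
  carrier := {v | ∃ ε > (0 : ℝ), ∀ δ, |δ| ≤ ε → x + δ • v ∈ P}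
  zero_mem' := ⟨1, one_pos, fun δ _ => by simpa using hx⟩
  add_mem' := by
    rintro v w ⟨ε, hε, hv⟩ ⟨η, hη, hw⟩
    refine ⟨min ε η / 2, by positivity, fun δ hδ => ?_⟩
    have h2 : |2 * δ| ≤ min ε η := by
      rw [abs_mul, abs_two]; linarith
    have h1 := hP (hv (2 * δ) (h2.trans (min_le_left _ _))) (hw (2 * δ) (h2.trans (min_le_right _ _)))
      (by norm_num : (0 : ℝ) ≤ 1 / 2) (by norm_num : (0 : ℝ) ≤ 1 / 2) (by norm_num)
    convert h1 using 1
    module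
  smul_mem' := by
    rintro c v ⟨ε, hε, hv⟩
    refine ⟨ε / (|c| + 1), by positivity, fun δ hδ => ?_⟩
    rw [smul_smul]
    refine hv _ ?_
    rw [le_div_iff₀ (by positivity)] at hδ
    rw [abs_mul]
    nlinarith [abs_nonneg δ]

/-- At an extreme point of a slice of `P` by a fibre of `L`, no nonzero two-sided direction of `P` lies
in the kernel of `L`. -/
theorem finrank_lineality_le {V V' : Type*} [AddCommGroup V] [Module ℝ V] [FiniteDimensional ℝ V]
    [AddCommGroup V'] [Module ℝ V'] [FiniteDimensional ℝ V'] {P : Set V} (hP : Convex ℝ P)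
    (L : V →ₗ[ℝ] V') {x : V} (hx : x ∈ {y ∈ P | L y = L x}.extremePoints ℝ) :
    Module.finrank ℝ (lineality hP hx.1.1) ≤ Module.finrank ℝ (LinearMap.range L) := by
  refine LinearMap.finrank_le_finrank_of_injective
    (f := L.rangeRestrict.comp (lineality hP hx.1.1).subtype) ?_
  rw [← LinearMap.ker_eq_bot, LinearMap.ker_eq_bot']
  rintro ⟨v, ε, hε, hv⟩ hLv
  have hLv : L v = 0 := congrArg Subtype.val hLv
  have h1 := hv ε (abs_of_pos hε).le
  have h2 := hv (-ε) (by rw [abs_neg, abs_of_pos hε])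
  have h3 := hx.2 (x₁ := x + ε • v) ⟨h1, by simp [hLv]⟩ (x₂ := x + (-ε) • v)
    ⟨h2, by simp [hLv]⟩ ⟨1 / 2, 1 / 2, by norm_num, by norm_num, by norm_num, by module⟩
  have h4 : ε • v = 0 := by simpa using h3
  exact Subtype.ext ((smul_eq_zero.1 h4).resolve_left hε.ne')

theorem charVec_insert_sdiff {E : Type*} [DecidableEq E] {B : Set E} {e f : E} (he : e ∈ B)
    (hf : f ∉ B) : charVec ℝ (insert f (B \ {e})) =
      charVec ℝ B + (Pi.single f 1 - Pi.single e 1) := by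
  classical
  ext g
  simp only [charVec, Set.indicator_apply, Set.mem_insert_iff, Set.mem_sdiff,
    Set.mem_singleton_iff, Pi.add_apply, Pi.sub_apply, Pi.single_apply, Pi.one_apply]
  have hef : e ≠ f := fun h => hf (h ▸ he)
  by_cases h1 : g = f
  · subst h1; simp [hf, hef.symm]
  · by_cases h2 : g = e
    · subst h2; simp [he, h1]
    · simp [h1, h2]

/-- An extreme point of a slice of the base polytope by a fibre of `L` is close to a basis. Write it as
a convex combination of bases with positive coefficients. For two of these bases `B`, `B'`, each
`e ∈ B \ B'` admits a symmetric exchange with some `f`, and `χ(f) - χ(e)` is a two-sided direction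
at the point: moving forward exchanges within `B`, moving backward within `B'`. These directions
are linearly independent for distinct `e`, so `|B \ B'|` is at most the rank of `L`. -/
theorem exists_isBase_near_extremePoint {E : Type*} [Fintype E] {V' : Type*} [AddCommGroup V']
    [Module ℝ V'] [FiniteDimensional ℝ V'] (M : Matroid E) (L : (E → ℝ) →ₗ[ℝ] V') {x : E → ℝ}
    (hx : x ∈ {y ∈ basePolytope M | L y = L x}.extremePoints ℝ) :
    ∃ B, M.IsBase B ∧
      ∑ e, |x e - charVec ℝ B e| ≤ 2 * (Module.finrank ℝ (LinearMap.range L) : ℝ) := by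
  classical
  have hconv : Convex ℝ (basePolytope M) := convex_convexHull ℝ _
  have hbase : ∀ B, M.IsBase B → charVec ℝ B ∈ basePolytope M := fun B hB =>
    subset_convexHull ℝ _ ⟨B, hB, rfl⟩
  set r := Module.finrank ℝ (LinearMap.range L)
  have hxP : x ∈ convexHull ℝ {x | ∃ B : Set E, M.IsBase B ∧ x = charVec ℝ B} := hx.1.1
  obtain ⟨κ, _, z, w, hz, -, hw, hw1, hwx⟩ := eq_pos_convex_span_of_mem_convexHull hxP
  choose 𝓑 h𝓑 hz𝓑 using fun i => hz (Set.mem_range_self i)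
  -- moving weight `δ` from one vertex to another point of the polytope stays inside the polytope
  have hmove : ∀ i v, charVec ℝ (𝓑 i) + v ∈ basePolytope M → ∀ δ, 0 ≤ δ → δ ≤ w i →
      x + δ • v ∈ basePolytope M := by
    intro i v hv δ hδ0 hδ
    have h1 : x + δ • v = ∑ j, (w j - if j = i then δ else 0) • charVec ℝ (𝓑 j) +
        δ • (charVec ℝ (𝓑 i) + v) := by
      rw [← hwx]
      simp only [hz𝓑, sub_smul, ite_smul, zero_smul, Finset.sum_sub_distrib, Finset.sum_ite_eq',
        Finset.mem_univ, if_true]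
      module
    rw [h1]
    have h2 := hconv.sum_mem (t := (Finset.univ : Finset (Option κ)))
      (w := fun o => o.elim δ fun j => w j - if j = i then δ else 0)
      (z := fun o => o.elim (charVec ℝ (𝓑 i) + v) fun j => charVec ℝ (𝓑 j))
      (by
        rintro (_ | j) _
        · exact hδ0
        · simp only [Option.elim_some, sub_nonneg]
          split_ifs with h
          · exact h ▸ hδ
          · exact (hw j).le)
      (by simp [Fintype.sum_option, hw1]) (by
        rintro (_ | j) _
        · exact hv
        · exact hbase _ (h𝓑 j))
    rw [Fintype.sum_option] at h2
    rw [add_comm]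
    exact h2
  have hdiff : ∀ i j, (𝓑 i \ 𝓑 j).ncard ≤ r := by
    intro i j
    choose! f hf hf1 hf2 using fun e (he : e ∈ 𝓑 i \ 𝓑 j) =>
      exists_symmetric_exchange (h𝓑 i) (h𝓑 j) he
    let D : Finset E := (𝓑 i \ 𝓑 j).toFinset
    have hD : ∀ e : D, (e : E) ∈ 𝓑 i \ 𝓑 j := fun e => Set.mem_toFinset.1 e.2
    let v : E → E → ℝ := fun e => Pi.single (f e) 1 - Pi.single e 1
    have hv : ∀ e : D, v e ∈ lineality hconv hx.1.1 := by
      intro e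
      have h1 := hmove i (v e) (by
        rw [← charVec_insert_sdiff (hD e).1 (hf e (hD e)).2]
        exact hbase _ (hf1 e (hD e)))
      have h2 := hmove j (-v e) (by
        have : -v e = Pi.single (e : E) 1 - Pi.single (f e) 1 := by simp [v]
        rw [this, ← charVec_insert_sdiff (hf e (hD e)).1 (hD e).2]
        exact hbase _ (hf2 e (hD e)))
      refine ⟨min (w i) (w j), lt_min (hw i) (hw j), fun δ hδ => ?_⟩
      rcases le_total 0 δ with h | h
      · rw [abs_of_nonneg h] at hδ
        exact h1 δ h (hδ.trans (min_le_left _ _))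
      · rw [abs_of_nonpos h] at hδ
        have := h2 (-δ) (by linarith) (hδ.trans (min_le_right _ _))
        simpa using this
    have hind : LinearIndependent ℝ fun e : D => (⟨v e, hv e⟩ : lineality hconv hx.1.1) := by
      rw [Fintype.linearIndependent_iff]
      intro g hg e
      have h1 := congrFun (congrArg Subtype.val hg) (e : E)
      simp only [Submodule.coe_sum, Submodule.coe_smul, Finset.sum_apply, Pi.smul_apply,
        smul_eq_mul, ZeroMemClass.coe_zero, Pi.zero_apply, v, Pi.sub_apply, Pi.single_apply] at h1
      rw [Finset.sum_eq_single e] at h1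
      · have : (e : E) ≠ f e := fun h => (hf e (hD e)).2 (h ▸ (hD e).1)
        simpa [this] using h1
      · intro e' _ hne
        have h2 : (e : E) ≠ f e' := fun h => (hf e' (hD e')).2 (h ▸ (hD e).1)
        have h3 : (e : E) ≠ e' := fun h => hne (Subtype.ext h.symm)
        simp [h2, h3]
      · simp
    have h1 := hind.fintype_card_le_finrank
    rw [Fintype.card_coe] at h1
    have h2 := finrank_lineality_le hconv L hx
    rw [Set.ncard_eq_toFinset_card']
    exact h1.trans h2
  have hne : Nonempty κ := by
    by_contra h
    rw [not_nonempty_iff] at h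
    simp at hw1
  obtain ⟨i⟩ := hne
  refine ⟨𝓑 i, h𝓑 i, ?_⟩
  have hdist : ∀ j, ∑ e, |charVec ℝ (𝓑 j) e - charVec ℝ (𝓑 i) e| ≤ 2 * (r : ℝ) := by
    intro j
    have h1 : ∀ e, |charVec ℝ (𝓑 j) e - charVec ℝ (𝓑 i) e| =
        charVec ℝ (𝓑 j \ 𝓑 i) e + charVec ℝ (𝓑 i \ 𝓑 j) e := by
      intro e
      by_cases h2 : e ∈ 𝓑 i <;> by_cases h3 : e ∈ 𝓑 j <;> simp [charVec, h2, h3]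
    have h2 : ∀ S : Set E, ∑ e, charVec ℝ S e = S.ncard := by
      intro S
      simp only [charVec, Set.indicator_apply, Pi.one_apply, Finset.sum_boole,
        Set.ncard_eq_toFinset_card']
      congr 2
      ext; simp
    simp only [h1, Finset.sum_add_distrib, h2]
    have h3 : ((𝓑 j \ 𝓑 i).ncard : ℝ) ≤ r := by exact_mod_cast hdiff j i
    have h4 : ((𝓑 i \ 𝓑 j).ncard : ℝ) ≤ r := by exact_mod_cast hdiff i j
    linarith
  calc ∑ e, |x e - charVec ℝ (𝓑 i) e|
      ≤ ∑ e, ∑ j, w j * |charVec ℝ (𝓑 j) e - charVec ℝ (𝓑 i) e| := by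
        refine Finset.sum_le_sum fun e _ => ?_
        have h1 : x e - charVec ℝ (𝓑 i) e =
            ∑ j, w j * (charVec ℝ (𝓑 j) e - charVec ℝ (𝓑 i) e) := by
          simp only [mul_sub, Finset.sum_sub_distrib, ← Finset.sum_mul, hw1, one_mul]
          rw [← hwx]
          simp [Finset.sum_apply, hz𝓑]
        rw [h1]
        refine (Finset.abs_sum_le_sum_abs _ _).trans (le_of_eq ?_)
        exact Finset.sum_congr rfl fun j _ => by rw [abs_mul, abs_of_pos (hw j)]
    _ = ∑ j, w j * ∑ e, |charVec ℝ (𝓑 j) e - charVec ℝ (𝓑 i) e| := by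
        rw [Finset.sum_comm]
        simp only [Finset.mul_sum]
    _ ≤ ∑ j, w j * (2 * r) :=
        Finset.sum_le_sum fun j _ => mul_le_mul_of_nonneg_left (hdist j) (hw j).le
    _ = 2 * r := by rw [← Finset.sum_mul, hw1, one_mul]

/-! ### The proximity bound -/

/-- The numerical estimate. With `q = 2 * m * Δ` it uses `K = (m+1)(2q+1)^m`, `p ≤ (q+1)^m` and
`(2q+1)(q+1) ≤ q^4`, which makes `K^2 * p^2` at most `(m+1)^2 * q^(8m)`. -/
theorem proximity_bound_le {m Δ K p n : ℕ} (hm : 0 < m) (hΔ : 0 < Δ)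
    (hK : K = (m + 1) * (2 * (m * (2 * Δ)) + 1) ^ m) (hp : p = (2 * Δ + 1) ^ m)
    (hn : n ≤ K * p ^ 2 + K * (2 * m * Δ + 2 * Δ * (K * p ^ 2))) :
    2 * m + 2 * n ≤ (2 * m * Δ) ^ (13 * m) := by
  obtain ⟨q, hq⟩ : ∃ q, q = 2 * m * Δ := ⟨_, rfl⟩
  have hmq : 2 * m ≤ q := by rw [hq]; exact Nat.le_mul_of_pos_right _ hΔ
  have hΔq : 2 * Δ ≤ q := by rw [hq]; nlinarith
  obtain ⟨a, ha⟩ : ∃ a, a = (2 * q + 1) ^ m := ⟨_, rfl⟩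
  have hK' : K = (m + 1) * a := by
    rw [hK, ha, hq]; ring_nf
  rw [← hq] at hn ⊢
  have hqpos : 2 ≤ q := by omega
  have ha1 : 2 * q + 1 ≤ a := by rw [ha]; exact Nat.le_self_pow hm.ne' _
  have hK1 : 4 * q + 2 ≤ K := by rw [hK']; nlinarith
  have hp1 : 1 ≤ p ^ 2 := by rw [hp]; exact Nat.one_le_pow _ _ (by positivity)
  have hap : a * p ≤ q ^ (4 * m) := by
    rw [ha, hp, ← mul_pow, pow_mul]
    refine Nat.pow_le_pow_left ?_ m
    calc (2 * q + 1) * (2 * Δ + 1) ≤ (2 * q + 1) * (q + 1) :=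
          Nat.mul_le_mul_left _ (by omega)
      _ ≤ q ^ 4 := by nlinarith [sq_nonneg (q ^ 2 - 4 : ℤ), mul_le_mul hqpos hqpos (by norm_num) (by omega)]
  have hlow : 2 * m + 2 * (K * p ^ 2) + 2 * (K * q) ≤ Δ * (K ^ 2 * p ^ 2) := by
    have h1 : K * p ^ 2 * (4 * q + 2) ≤ K * p ^ 2 * K := Nat.mul_le_mul_left _ hK1
    have h2 : K * q ≤ K * p ^ 2 * q := by
      rw [mul_assoc]; exact Nat.mul_le_mul_left _ (Nat.le_mul_of_pos_left _ hp1)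
    have h3 : q ≤ K * q := Nat.le_mul_of_pos_left _ (by omega)
    have h4 : K * p ^ 2 * K ≤ Δ * (K ^ 2 * p ^ 2) := by
      rw [show K * p ^ 2 * K = K ^ 2 * p ^ 2 by ring]
      exact Nat.le_mul_of_pos_left _ hΔ
    linarith
  have hmain : 5 * Δ * (m + 1) ^ 2 ≤ q ^ (5 * m) := by
    have h1 : (m + 1) ^ 2 ≤ 4 * m ^ 2 := by nlinarith
    have h2 : Δ * (4 * m ^ 2) ≤ q ^ 2 := by
      rw [hq]
      nlinarith [Nat.mul_le_mul_left (4 * m ^ 2 * Δ) hΔ]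
    have h3 : 5 ≤ q ^ 3 := le_trans (by norm_num) (Nat.pow_le_pow_left hqpos 3)
    calc 5 * Δ * (m + 1) ^ 2 = 5 * (Δ * (m + 1) ^ 2) := by ring
      _ ≤ q ^ 3 * q ^ 2 := Nat.mul_le_mul h3 ((Nat.mul_le_mul_left _ h1).trans h2)
      _ = q ^ 5 := by ring
      _ ≤ q ^ (5 * m) := Nat.pow_le_pow_right (by omega) (by omega)
  calc 2 * m + 2 * n ≤ 2 * m + 2 * (K * p ^ 2) + 2 * (K * q) + 4 * (Δ * (K ^ 2 * p ^ 2)) := by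
        nlinarith
    _ ≤ 5 * (Δ * (K ^ 2 * p ^ 2)) := by linarith
    _ = 5 * Δ * (m + 1) ^ 2 * (a * p) ^ 2 := by rw [hK']; ring
    _ ≤ q ^ (5 * m) * (q ^ (4 * m)) ^ 2 :=
        Nat.mul_le_mul hmain (Nat.pow_le_pow_left hap 2)
    _ = q ^ (13 * m) := by rw [← pow_mul, ← pow_add]; congr 1; ring

theorem sum_charVec_mul {E R : Type*} [Fintype E] [NonAssocSemiring R] (S : Finset E) (g : E → R) :
    ∑ e, g e * charVec R (S : Set E) e = ∑ e ∈ S, g e := by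
  classical
  simp [charVec, Set.indicator_apply]

theorem weight_apply {E : Type*} [Fintype E] {m : ℕ} (W : Matrix (Fin m) E ℤ) (S : Finset E)
    (k : Fin m) : weight W (S : Set E) k = ∑ e ∈ S, W k e :=
  sum_charVec_mul S (W k)

theorem sum_abs_charVec_sub {E : Type*} [Fintype E] [DecidableEq E] (S T : Finset E) :
    ∑ e, |charVec ℝ (S : Set E) e - charVec ℝ (T : Set E) e| =
      (S \ T).card + (T \ S).card := by
  have h1 : ∀ e, |charVec ℝ (S : Set E) e - charVec ℝ (T : Set E) e| =
      1 * charVec ℝ ((S \ T : Finset E) : Set E) e +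
        1 * charVec ℝ ((T \ S : Finset E) : Set E) e := by
    intro e
    by_cases h2 : e ∈ S <;> by_cases h3 : e ∈ T <;> simp [charVec, h2, h3]
  simp only [h1, Finset.sum_add_distrib, sum_charVec_mul]
  simp


end MatroidProximity

open MatroidProximity

theorem theorem2 {E : Type*} [Fintype E] (M : Matroid E) (hE : M.E = Set.univ)
    (m Δ : ℕ) (W : Matrix (Fin m) E ℤ) (hW : ∀ i e, |W i e| ≤ (Δ : ℤ))
    (A : Set E) (hA : M.IsBase A)
    (x : E → ℝ)
    (hx : x ∈ (MatroidProximity.exactPolytope M W (MatroidProximity.weight W A)).extremePoints ℝ) :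
    ∃ A' : Set E, M.IsBase A' ∧
      MatroidProximity.weight W A' = MatroidProximity.weight W A ∧
      ∑ e, |x e - MatroidProximity.charVec ℝ A' e| ≤ (2 * (m : ℝ) * (Δ : ℝ)) ^ (13 * m) := by
  classical
  let L : (E → ℝ) →ₗ[ℝ] (Fin m → ℝ) := (W.map fun z : ℤ => (z : ℝ)).mulVecLin
  have hxW : L x = fun i => (weight W A i : ℝ) := hx.1.2
  have hx' : x ∈ {y ∈ basePolytope M | L y = L x}.extremePoints ℝ := by
    rw [hxW]
    exact hx
  obtain ⟨B', hB', hxB⟩ := exists_isBase_near_extremePoint M L hx'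
  obtain ⟨B, rfl⟩ : ∃ B : Finset E, (B : Set E) = B' := ⟨B'.toFinset, by simp⟩
  obtain ⟨A, rfl⟩ : ∃ A₀ : Finset E, (A₀ : Set E) = A := ⟨A.toFinset, by simp⟩
  have hrank : Module.finrank ℝ (LinearMap.range L) ≤ m := by
    simpa using Submodule.finrank_le (LinearMap.range L)
  rcases Nat.eq_zero_or_pos (m * Δ) with h0 | hpos
  · -- all weights vanish, and `x` itself is the characteristic vector of a basis
    have hW0 : W = 0 := by
      ext i e
      rcases Nat.mul_eq_zero.1 h0 with rfl | rfl
      · exact i.elim0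
      · simpa using hW i e
    have hL0 : L = 0 := by
      ext v i
      simp [L, hW0]
    refine ⟨B, hB', by simp [weight, hW0], ?_⟩
    rw [hL0, LinearMap.range_zero, finrank_bot] at hxB
    refine (hxB.trans (by simp)).trans (by positivity : (0 : ℝ) ≤ _)
  · have hm : 0 < m := Nat.pos_of_mul_pos_right hpos
    have hΔ : 0 < Δ := Nat.pos_of_mul_pos_left hpos
    have hxB' : ∑ e, |x e - charVec ℝ (B : Set E) e| ≤ 2 * m := by
      have : (Module.finrank ℝ (LinearMap.range L) : ℝ) ≤ m := by exact_mod_cast hrank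
      linarith
    obtain ⟨A', hA', hmin⟩ := Finset.exists_min_image
      (Finset.univ.filter fun S : Finset E =>
        M.IsBase (S : Set E) ∧ ∀ k, ∑ e ∈ S, W k e = ∑ e ∈ A, W k e)
      (fun S => (S \ B).card) ⟨A, by simpa using hA⟩
    simp only [Finset.mem_filter, Finset.mem_univ, true_and] at hA' hmin
    obtain ⟨hA'base, hA'W⟩ := hA'
    have hR : ∀ k, |∑ e ∈ B, W k e - ∑ e ∈ A', W k e| ≤ (2 * m * Δ : ℕ) := by
      intro k
      have h1 : ∑ e, (W k e : ℝ) * x e = ((∑ e ∈ A, W k e : ℤ) : ℝ) := by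
        rw [← weight_apply]
        exact congrFun hxW k
      have h2 : ((∑ e ∈ B, W k e - ∑ e ∈ A', W k e : ℤ) : ℝ) =
          -∑ e, (W k e : ℝ) * (x e - charVec ℝ (B : Set E) e) := by
        simp only [mul_sub, Finset.sum_sub_distrib, h1, sum_charVec_mul, hA'W]
        push_cast
        ring
      have h3 : |((∑ e ∈ B, W k e - ∑ e ∈ A', W k e : ℤ) : ℝ)| ≤ (2 * m * Δ : ℕ) := by
        rw [h2, abs_neg]
        calc |∑ e, (W k e : ℝ) * (x e - charVec ℝ (B : Set E) e)|
            ≤ ∑ e, |(W k e : ℝ) * (x e - charVec ℝ (B : Set E) e)| :=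
              Finset.abs_sum_le_sum_abs _ _
          _ ≤ ∑ e, (Δ : ℝ) * |x e - charVec ℝ (B : Set E) e| := by
              refine Finset.sum_le_sum fun e _ => ?_
              rw [abs_mul]
              refine mul_le_mul_of_nonneg_right ?_ (abs_nonneg _)
              exact_mod_cast hW k e
          _ ≤ (Δ : ℝ) * (2 * m) := by
              rw [← Finset.mul_sum]
              exact mul_le_mul_of_nonneg_left hxB' (by positivity)
          _ = (2 * m * Δ : ℕ) := by push_cast; ring
      exact_mod_cast h3
    -- otherwise `A'` would not be closest to `B`
    have hn : (A' \ B).card ≤ _ := not_lt.1 fun hlt => by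
      obtain ⟨A'', hA'', hW'', hlt'⟩ := exists_isBase_card_sdiff_lt hA'base hB' W Δ (2 * m * Δ) _
        hW hR rfl hlt
      exact absurd (hmin A'' ⟨hA'', fun k => (hW'' k).trans (hA'W k)⟩) (not_le.2 hlt')
    have hbound := proximity_bound_le hm hΔ rfl rfl hn
    refine ⟨A', hA'base, funext fun k => by rw [weight_apply, weight_apply, hA'W], ?_⟩
    have hcard : (B \ A').card = (A' \ B).card := by
      have h1 := hB'.ncard_eq_ncard_of_isBase hA'base
      rw [Set.ncard_coe_finset, Set.ncard_coe_finset] at h1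
      exact Finset.card_sdiff_comm h1
    calc ∑ e, |x e - charVec ℝ (A' : Set E) e|
        ≤ ∑ e, (|x e - charVec ℝ (B : Set E) e| +
            |charVec ℝ (B : Set E) e - charVec ℝ (A' : Set E) e|) :=
          Finset.sum_le_sum fun e _ => abs_sub_le _ _ _
      _ ≤ 2 * m + 2 * (A' \ B).card := by
          rw [Finset.sum_add_distrib, sum_abs_charVec_sub, hcard]
          linarith
      _ ≤ (2 * (m : ℝ) * (Δ : ℝ)) ^ (13 * m) := by exact_mod_cast hbound
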